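/- We use $L_{\omega_1\omega}$ over the language of fields $\{+,-,\cdot,0,1\}$. Here $\Sigma_0=\Pi_0$ is the class of finitary quantifier-free formulas; for $k\ge 1$, a $\Sigma_k$ formula is a countable disjunction of formulas $\exists\bar u\,\psi$ with $\psi$ a $\Pi_j$ formula for some $j<k$, and a $\Pi_k$ formula is a countable conjunction of formulas $\forall\bar u\,\psi$ with $\psi$ a $\Sigma_j$ formula for some $j<k$. A Scott sentence of a countable structure $\mathcal A$ is a sentence of $L_{\omega_1\omega}$ whose countable models are exactly the isomorphic copies of $\mathcal A$. Let $\operatorname{FD}_1$ be the class of fields of characteristic $0$ and transcendence degree $1$ over $\mathbb{Q}$. **Proposition.** There exists $F\in\operatorname{FD}_1$ with no $\Pi_3$ Scott sentence. More precisely, in the algebraic closure $\overline{\mathbb{Q}(t)}$ of the rational function field $\mathbb{Q}(t)$ one can choose, for each odd prime $p$, a $p$-th root $t^{1/p}$ of $t$; and for every such choice the subfield $F\subseteq\overline{\mathbb{Q}(t)}$ generated by $\{t^{1/p} : p \text{ an odd prime}\}$ has the following properties: 1. $F$ has characteristic $0$ and transcendence degree $1$ over $\mathbb{Q}$, and $\{t\}$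 is a transcendence basis of $F$ over $\mathbb{Q}$; 2. the orbit of $t$ under the automorphism group of $F$ is not defined in $F$ by any (parameter-free) $\Sigma_2$ formula of $L_{\omega_1\omega}$; 3. $F$ has no $\Pi_3$ Scott sentence. -/

import Mathlib

/-! ### The infinitary logic `L_{ω₁ω}` -/

/-- Formulas of `L_{ω₁ω}` whose free variables are among `x_0, …, x_{n-1}`: first-order
syntax together with conjunctions and disjunctions of countable families of formulas
(in the same finitely many free variables). The quantifiers bind the last variable `x_n`
of a formula in `n + 1` variables. -/
inductive InfFormula (L : FirstOrder.Language.{0, 0}) : ℕ → Type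
  | falsum {n : ℕ} : InfFormula L n
  | equal {n : ℕ} (s t : L.Term (Fin n)) : InfFormula L n
  | rel {n l : ℕ} (R : L.Relations l) (ts : Fin l → L.Term (Fin n)) : InfFormula L n
  | imp {n : ℕ} (φ ψ : InfFormula L n) : InfFormula L n
  | conj {n : ℕ} (φ : ℕ → InfFormula L n) : InfFormula L n
  | disj {n : ℕ} (φ : ℕ → InfFormula L n) : InfFormula L n
  | all {n : ℕ} (φ : InfFormula L (n + 1)) : InfFormula L n
  | ex {n : ℕ} (φ : InfFormula L (n + 1)) : InfFormula L n

namespace InfFormula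

variable {L : FirstOrder.Language.{0, 0}}

/-- Satisfaction of a formula in the structure `M` under the assignment `v`. -/
def Realize {M : Type} [L.Structure M] : {n : ℕ} → InfFormula L n → (Fin n → M) → Prop
  | _, falsum, _ => False
  | _, equal s t, v => s.realize v = t.realize v
  | _, rel R ts, v => FirstOrder.Language.Structure.RelMap R (fun i => (ts i).realize v)
  | _, imp φ ψ, v => φ.Realize v → ψ.Realize v
  | _, conj φ, v => ∀ i, (φ i).Realize v
  | _, disj φ, v => ∃ i, (φ i).Realize v
  | _, all φ, v => ∀ x : M, φ.Realize (Fin.snoc v x)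
  | _, ex φ, v => ∃ x : M, φ.Realize (Fin.snoc v x)

/-- The block of universal quantifiers `∀ x_n … ∀ x_{n+m-1}`. -/
def alls {n : ℕ} : (m : ℕ) → InfFormula L (n + m) → InfFormula L n
  | 0, φ => φ
  | m + 1, φ => alls m (all φ)

/-- The block of existential quantifiers `∃ x_n … ∃ x_{n+m-1}`. -/
def exs {n : ℕ} : (m : ℕ) → InfFormula L (n + m) → InfFormula L n
  | 0, φ => φ
  | m + 1, φ => exs m (ex φ)

/-- Finitary quantifier-free formulas (`falsum` and `imp` give all Boolean connectives). -/
inductive IsQF : {n : ℕ} → InfFormula L n → Prop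
  | falsum {n : ℕ} : IsQF (falsum : InfFormula L n)
  | equal {n : ℕ} (s t : L.Term (Fin n)) : IsQF (equal s t)
  | rel {n l : ℕ} (R : L.Relations l) (ts : Fin l → L.Term (Fin n)) : IsQF (rel R ts)
  | imp {n : ℕ} {φ ψ : InfFormula L n} : IsQF φ → IsQF ψ → IsQF (imp φ ψ)

mutual

/-- `IsSigma k φ`: `φ` is a `Σ_k` formula of `L_{ω₁ω}`. The `Σ_0` formulas are the finitary
quantifier-free ones; for `k > 0`, a `Σ_k` formula is a countable disjunction of formulas
`∃ ū, ψ` with `ψ` a `Π_j` formula for some `j < k` (which may vary with the disjunct). -/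
inductive IsSigma : ℕ → {n : ℕ} → InfFormula L n → Prop
  | qf {n : ℕ} {φ : InfFormula L n} (h : IsQF φ) : IsSigma 0 φ
  | disj {k n : ℕ} (j : ℕ → ℕ) (m : ℕ → ℕ) (ψ : (i : ℕ) → InfFormula L (n + m i))
      (hj : ∀ i, j i < k) (h : ∀ i, IsPi (j i) (ψ i)) :
      IsSigma k (disj fun i => exs (m i) (ψ i))

/-- `IsPi k φ`: `φ` is a `Π_k` formula of `L_{ω₁ω}`. The `Π_0` formulas are the finitary
quantifier-free ones; for `k > 0`, a `Π_k` formula is a countable conjunction of formulas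
`∀ ū, ψ` with `ψ` a `Σ_j` formula for some `j < k` (which may vary with the conjunct). -/
inductive IsPi : ℕ → {n : ℕ} → InfFormula L n → Prop
  | qf {n : ℕ} {φ : InfFormula L n} (h : IsQF φ) : IsPi 0 φ
  | conj {k n : ℕ} (j : ℕ → ℕ) (m : ℕ → ℕ) (ψ : (i : ℕ) → InfFormula L (n + m i))
      (hj : ∀ i, j i < k) (h : ∀ i, IsSigma (j i) (ψ i)) :
      IsPi k (conj fun i => alls (m i) (ψ i))

end

/-- `φ` is a Scott sentence of `M`: its countable models are exactly the isomorphic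
copies of `M`. -/
def IsScottSentence (φ : InfFormula L 0) (M : Type) [L.Structure M] : Prop :=
  ∀ (N : Type) [L.Structure N] [Countable N],
    φ.Realize (M := N) Fin.elim0 ↔ Nonempty (L.Equiv M N)

/-- `φ` defines (without parameters) the orbit of the tuple `a` under the automorphism
group of `M`. -/
def DefinesOrbit {n : ℕ} (φ : InfFormula L n) {M : Type} [L.Structure M]
    (a : Fin n → M) : Prop :=
  ∀ b : Fin n → M, φ.Realize b ↔ ∃ σ : L.Equiv M M, ∀ i, σ (a i) = b i

end InfFormula

/-! ### Fields as first-order structures -/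

/-- The function symbols of the language of fields: `+`, `-`, `·` (binary), `0`, `1`. -/
inductive FieldFunc : ℕ → Type
  | add : FieldFunc 2
  | sub : FieldFunc 2
  | mul : FieldFunc 2
  | zero : FieldFunc 0
  | one : FieldFunc 0

/-- The language of fields `{+, -, ·, 0, 1}`. -/
def fieldLang : FirstOrder.Language.{0, 0} where
  Functions := FieldFunc
  Relations := fun _ => Empty

/-- A field as a structure for the language of fields. -/
instance fieldLangStructure (F : Type) [Field F] : fieldLang.Structure F where
  funMap {n} f :=
    match n, f with
    | _, FieldFunc.add => fun x => x 0 + x 1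
    | _, FieldFunc.sub => fun x => x 0 - x 1
    | _, FieldFunc.mul => fun x => x 0 * x 1
    | _, FieldFunc.zero => fun _ => 0
    | _, FieldFunc.one => fun _ => 1
  RelMap r := nomatch r

/-- `F` belongs to `FD_r`: `F` has characteristic `0` and transcendence degree `r`
over `ℚ`. -/
def IsFD (r : ℕ) (F : Type) [Field F] : Prop :=
  ∃ _ : CharZero F, Algebra.trdeg ℚ F = (r : Cardinal)

/-! ### The field generated by roots of `t` of odd prime order -/

/-- The algebraic closure of the rational function field `ℚ(t)`. -/
abbrev QtBar : Type := AlgebraicClosure (RatFunc ℚ)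

/-- The element `t` of the algebraic closure of `ℚ(t)`. -/
noncomputable def tElt : QtBar := algebraMap (RatFunc ℚ) QtBar RatFunc.X

/-- `ρ p` is a `p`-th root of `t`, for each odd prime `p`. -/
def IsOddRootSystem (ρ : ℕ → QtBar) : Prop :=
  ∀ p : ℕ, p.Prime → p ≠ 2 → ρ p ^ p = tElt

/-- The subfield of the algebraic closure of `ℚ(t)` generated by `ρ p`, `p` an odd prime. -/
noncomputable def oddRootField (ρ : ℕ → QtBar) : Subfield QtBar :=
  Subfield.closure {x | ∃ p : ℕ, p.Prime ∧ p ≠ 2 ∧ x = ρ p}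

theorem tElt_mem_oddRootField {ρ : ℕ → QtBar} (hρ : IsOddRootSystem ρ) :
    tElt ∈ oddRootField ρ := by
  rw [← hρ 3 Nat.prime_three (by decide)]
  have h : ρ 3 ∈ oddRootField ρ :=
    Subfield.subset_closure (by exact ⟨3, Nat.prime_three, by decide, rfl⟩)
  exact pow_mem h 3

-- Write `F_R` for the field generated by `t` and the chosen roots `t^{1/p}`, `p ∈ R`, and `F` for
-- `F_R` with `R` the set of all odd primes. Two facts drive the proof. First, a true `Σ₂` formula
-- needs only finitely many witnesses and survives in every subfield containing them
-- (`IsSigma.exists_finite_witness`); finitely many elements lie in some `F_A` with `A` finite.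
-- Second, dropping one prime `q ∈ R` does not change the isomorphism type: `t ↦ t^q` extends to an
-- isomorphism from `F_R` onto `F_{R \ {q}}` sending `t^{1/q}` to `t`
-- (`IsRootSystem.exists_ringEquiv_diff_singleton`).
--
-- Hence a `Σ₂` formula true of `t` in `F` stays true of `t` after some `q` is dropped, and so is
-- true of `t^{1/q}` in `F`. But `t^{1/q}` is not in the orbit of `t`, since it has no `q`-th root
-- in `F` (`IsRootSystem.pow_ne`).
--
-- For a `Π₃` sentence true in `F`, a set `R` is built from finite conditions
-- (`IsRootSystem.exists_realize_coinfinite`). Every `F_R` with `R` cofinite is a copy of `F`, so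
-- each `Σ₂` instance can be secured by finitely many primes; countably many such requirements are
-- met while infinitely many primes are left out. The resulting `F_R` satisfies the sentence but is
-- not isomorphic to `F`: by a degree count, its elements with roots of all odd prime orders are
-- algebraic (`IsRootSystem.isAlgebraic_of_forall_exists_pow_eq`).

namespace InfFormula

-- Semantics of quantifier blocks

section Blocks

variable {L : FirstOrder.Language.{0, 0}} {M : Type} [L.Structure M]

theorem realize_exs {n : ℕ} (m : ℕ) (φ : InfFormula L (n + m)) (v : Fin n → M) :
    (exs m φ).Realize v ↔ ∃ w : Fin m → M, φ.Realize (Fin.append v w) := by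
  induction m with
  | zero =>
    constructor
    · intro h
      refine ⟨Fin.elim0, ?_⟩
      rw [Fin.append_elim0]
      exact h
    · rintro ⟨w, h⟩
      rw [Subsingleton.elim w Fin.elim0, Fin.append_elim0] at h
      exact h
  | succ m ih =>
    rw [exs, ih]
    constructor
    · rintro ⟨w, x, h⟩
      refine ⟨Fin.snoc w x, ?_⟩
      rw [Fin.append_snoc]
      exact h
    · rintro ⟨w, h⟩
      refine ⟨Fin.init w, w (Fin.last m), ?_⟩
      rw [← Fin.append_snoc, Fin.snoc_init_self]
      exact h

theorem realize_alls {n : ℕ} (m : ℕ) (φ : InfFormula L (n + m)) (v : Fin n → M) :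
    (alls m φ).Realize v ↔ ∀ w : Fin m → M, φ.Realize (Fin.append v w) := by
  induction m with
  | zero =>
    constructor
    · intro h w
      rw [Subsingleton.elim w Fin.elim0, Fin.append_elim0]
      exact h
    · intro h
      have := h Fin.elim0
      rw [Fin.append_elim0] at this
      exact this
  | succ m ih =>
    rw [alls, ih]
    constructor
    · intro h w
      have := h (Fin.init w) (w (Fin.last m))
      rw [← Fin.append_snoc, Fin.snoc_init_self] at this
      exact this
    · intro h w x
      have := h (Fin.snoc w x)
      rw [Fin.append_snoc] at this
      exact this

end Blocks

theorem IsSigma.isQF {L : FirstOrder.Language.{0, 0}} {n : ℕ} {φ : InfFormula L n}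
    (h : IsSigma 0 φ) : IsQF φ := by
  cases h with
  | qf h => exact h
  | disj j m ψ hj hψ => exact absurd (hj 0) (Nat.not_lt_zero _)

theorem comp_finAppend {α β : Type} {m n : ℕ} (f : α → β) (v : Fin m → α) (w : Fin n → α) :
    f ∘ Fin.append v w = Fin.append (f ∘ v) (f ∘ w) := by
  ext i
  refine Fin.addCases (fun i => ?_) (fun i => ?_) i <;> simp

-- Formulas of low complexity under field embeddings

section RingHom

variable {M N : Type} [Field M] [Field N]

theorem map_term_realize (f : N →+* M) {n : ℕ} (v : Fin n → N) (t : fieldLang.Term (Fin n)) :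
    t.realize (f ∘ v) = f (t.realize v) := by
  induction t with
  | var i => rfl
  | func F ts ih =>
    simp only [FirstOrder.Language.Term.realize, ih]
    cases F
    · exact (map_add f _ _).symm
    · exact (map_sub f _ _).symm
    · exact (map_mul f _ _).symm
    · exact (map_zero f).symm
    · exact (map_one f).symm

/-- Field embeddings preserve and reflect quantifier-free formulas. -/
theorem IsQF.realize_comp_iff (f : N →+* M) {n : ℕ} {φ : InfFormula fieldLang n} (h : IsQF φ)
    (v : Fin n → N) : φ.Realize (f ∘ v) ↔ φ.Realize v := by
  induction h with
  | falsum => exact Iff.rfl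
  | equal s t =>
    change s.realize (f ∘ v) = t.realize (f ∘ v) ↔ s.realize v = t.realize v
    rw [map_term_realize, map_term_realize, f.injective.eq_iff]
  | rel R ts => exact R.elim
  | imp _ _ ih₁ ih₂ => exact imp_congr (ih₁) (ih₂)

/-- `Π₁` formulas are inherited by subfields. -/
theorem IsPi.realize_of_comp (f : N →+* M) {k n : ℕ} {φ : InfFormula fieldLang n}
    (h : IsPi k φ) (hk : k ≤ 1) (v : Fin n → N) (hM : φ.Realize (f ∘ v)) : φ.Realize v := by
  cases h with
  | qf h => exact (h.realize_comp_iff f v).1 hM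
  | conj j m ψ hj hψ =>
    intro i
    have hi := hM i
    rw [realize_alls] at hi ⊢
    intro w
    have hji : j i = 0 := by have := hj i; omega
    have hs := hψ i
    rw [hji] at hs
    rw [← hs.isQF.realize_comp_iff f, comp_finAppend]
    exact hi _

/-- The truth of a `Σ₂` formula in a field is witnessed by finitely many elements: it passes to
every subfield containing them. -/
theorem IsSigma.exists_finite_witness {k n : ℕ} {φ : InfFormula fieldLang n}
    (h : IsSigma k φ) (hk : k ≤ 2) (v : Fin n → M) (hM : φ.Realize v) :
    ∃ S : Set M, S.Finite ∧ ∀ (N : Type) [Field N] (f : N →+* M) (u : Fin n → N),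
      S ⊆ Set.range f → f ∘ u = v → φ.Realize u := by
  cases h with
  | qf h =>
    refine ⟨∅, Set.finite_empty, fun N _ f u _ hu => ?_⟩
    rw [← hu] at hM
    exact (h.realize_comp_iff f u).1 hM
  | disj j m ψ hj hψ =>
    obtain ⟨i, hi⟩ := hM
    rw [realize_exs] at hi
    obtain ⟨w, hw⟩ := hi
    refine ⟨Set.range w, Set.finite_range w, fun N _ f u hS hu => ⟨i, ?_⟩⟩
    rw [realize_exs]
    choose w' hw' using fun l => hS (Set.mem_range_self l)
    refine ⟨w', (hψ i).realize_of_comp f (by have := hj i; omega) _ ?_⟩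
    have hww : f ∘ w' = w := funext hw'
    rw [comp_finAppend, hu, hww]
    exact hw

/-- A field isomorphism preserves the truth of `Σ₂` formulas. -/
theorem IsSigma.realize_comp_equiv {k n : ℕ} {φ : InfFormula fieldLang n}
    (h : IsSigma k φ) (hk : k ≤ 2) (e : N ≃+* M) (v : Fin n → M) (hM : φ.Realize v) :
    φ.Realize (e.symm ∘ v) := by
  obtain ⟨S, -, hS⟩ := h.exists_finite_witness hk v hM
  refine hS N e.toRingHom _ (fun x _ => ⟨e.symm x, by simp⟩) ?_
  ext i
  simp

/-- An isomorphism of field structures is a ring isomorphism. -/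
def ringEquivOfEquiv (σ : fieldLang.Equiv M N) : M ≃+* N where
  toEquiv := σ.toEquiv
  map_add' x y := σ.map_fun FieldFunc.add ![x, y]
  map_mul' x y := σ.map_fun FieldFunc.mul ![x, y]

/-- A ring isomorphism of fields is an isomorphism of field structures. -/
def equivOfRingEquiv (e : M ≃+* N) : fieldLang.Equiv M N where
  toEquiv := e.toEquiv
  map_fun' F x := by
    cases F
    · exact map_add e _ _
    · exact map_sub e _ _
    · exact map_mul e _ _
    · exact map_zero e
    · exact map_one e
  map_rel' R := R.elim

end RingHom

end InfFormula

section

open Polynomial IntermediateField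

-- Common roots by Bézout

section PowersInFields

variable {K : Type} [Field K]

/-- Elements `x`, `y` with `x ^ m = y ^ n`, `m` and `n` coprime, are powers of one element. -/
theorem exists_pow_eq_and_pow_eq {x y : K} {m n : ℕ} (hx : x ≠ 0) (hy : y ≠ 0)
    (hmn : Nat.Coprime m n) (h : x ^ m = y ^ n) : ∃ z : K, z ^ n = x ∧ z ^ m = y := by
  have hb : (m : ℤ) * m.gcdA n + n * m.gcdB n = 1 := by
    rw [← Nat.gcd_eq_gcd_ab, hmn.gcd_eq_one, Nat.cast_one]
  have h' : x ^ (m : ℤ) = y ^ (n : ℤ) := by rw [zpow_natCast, zpow_natCast, h]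
  -- With `m * a + n * b = 1` and `z = y ^ a * x ^ b`, one gets `z ^ n = x ^ (m * a + n * b)` and `z
  -- ^ m = y ^ (m * a + n * b)`.
  refine ⟨y ^ (m.gcdA n) * x ^ (m.gcdB n), ?_, ?_⟩
  · rw [← zpow_natCast, mul_zpow, ← zpow_mul, mul_comm (m.gcdA n), zpow_mul, ← h', ← zpow_mul,
      ← zpow_mul, ← zpow_add₀ hx, mul_comm (m.gcdB n), hb, zpow_one]
  · rw [← zpow_natCast, mul_zpow, ← zpow_mul, ← zpow_mul, mul_comm (m.gcdB n), zpow_mul x, h',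
      ← zpow_mul, ← zpow_add₀ hy, mul_comm (m.gcdA n), hb, zpow_one]

theorem IntermediateField.mem_of_pow_mem_of_coprime {k : Type} [Field k] [Algebra k K]
    (E : IntermediateField k K) {x : K} {m n : ℕ} (hmn : Nat.Coprime m n)
    (hm : x ^ m ∈ E) (hn : x ^ n ∈ E) : x ∈ E := by
  rcases eq_or_ne x 0 with rfl | hx
  · exact zero_mem E
  have hb : (m : ℤ) * m.gcdA n + n * m.gcdB n = 1 := by
    rw [← Nat.gcd_eq_gcd_ab, hmn.gcd_eq_one, Nat.cast_one]
  have : x = (x ^ m) ^ (m.gcdA n) * (x ^ n) ^ (m.gcdB n) := by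
    rw [← zpow_natCast, ← zpow_natCast, ← zpow_mul, ← zpow_mul, ← zpow_add₀ hx, hb, zpow_one]
  rw [this]
  exact mul_mem (zpow_mem hm _) (zpow_mem hn _)

/-- Given an `n`-th root `x` of `t` and roots `ρ p` of `t` of orders `p ∈ C` pairwise coprime and
coprime to `n`, the element `x` and all `ρ p` are powers of one element. -/
theorem exists_common_root {t x : K} {n : ℕ} {ρ : ℕ → K} (ht : t ≠ 0) (hn0 : 0 < n) (hx : x ^ n = t)
    (C : Finset ℕ) (hC : ∀ p ∈ C, ρ p ^ p = t) (hn : ∀ p ∈ C, Nat.Coprime n p)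
    (hp : ∀ p ∈ C, 0 < p) (hpair : (C : Set ℕ).Pairwise Nat.Coprime) :
    ∃ y : K, y ^ (∏ p ∈ C, p) = x ∧ ∀ p ∈ C, y ^ (n * ∏ q ∈ C.erase p, q) = ρ p := by
  induction C using Finset.induction_on with
  | empty => exact ⟨x, by simp, by simp⟩
  | insert q C hq ih =>
    simp only [Finset.mem_insert, forall_eq_or_imp, Finset.coe_insert] at hC hn hp hpair
    obtain ⟨y, hyx, hy⟩ := ih hC.2 hn.2 hp.2 (hpair.mono (Set.subset_insert _ _))
    have hyt : y ^ (n * ∏ p ∈ C, p) = ρ q ^ q := by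
      rw [mul_comm, pow_mul, hyx, hx, hC.1]
    have hρ0 : ρ q ≠ 0 := fun h0 => by
      have := hC.1
      rw [h0, zero_pow hp.1.ne'] at this
      exact ht this.symm
    have hy0 : y ≠ 0 := by
      rintro rfl
      rw [zero_pow (Finset.prod_pos fun p h => hp.2 p h).ne'] at hyx
      rw [← hyx, zero_pow hn0.ne'] at hx
      exact ht hx.symm
    have hcop : Nat.Coprime (n * ∏ p ∈ C, p) q :=
      Nat.Coprime.mul_left hn.1 (Nat.Coprime.prod_left fun p hpC =>
        hpair (Set.mem_insert_of_mem _ hpC) (Set.mem_insert _ _) (by rintro rfl; exact hq hpC))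
    obtain ⟨z, hzy, hzq⟩ := exists_pow_eq_and_pow_eq hy0 hρ0 hcop hyt
    refine ⟨z, ?_, ?_⟩
    · rw [Finset.prod_insert hq, pow_mul, hzy, hyx]
    · intro p hpC
      rcases Finset.mem_insert.1 hpC with rfl | hpC
      · rw [Finset.erase_insert hq, hzq]
      · have hqp : q ≠ p := by rintro rfl; exact hq hpC
        rw [Finset.erase_insert_of_ne hqp, Finset.prod_insert (by simp [hq]), ← hy p hpC, ← hzy,
          ← pow_mul]
        congr 1
        ring

end PowersInFields

-- Perfect powers in a simple transcendental extension

section Degree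

variable {K : Type} [Field K] [Algebra ℚ K]

theorem exists_isCoprime_of_mem_adjoin_simple {x y : K} (hy : y ∈ ℚ⟮x⟯) :
    ∃ A B : ℚ[X], IsCoprime A B ∧ B ≠ 0 ∧ y = aeval x A / aeval x B := by
  obtain ⟨r, s, rfl⟩ := (mem_adjoin_simple_iff ℚ y).1 hy
  rcases eq_or_ne (aeval x s) 0 with hs | hs
  -- Division by zero gives `y = 0` here, written as `0 / 1`.
  · exact ⟨0, 1, isCoprime_one_right, one_ne_zero, by simp [hs]⟩
  have hs0 : s ≠ 0 := by rintro rfl; simp at hs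
  have h0 : EuclideanDomain.gcd r s ≠ 0 := fun h => hs0 (EuclideanDomain.gcd_eq_zero_iff.1 h).2
  obtain ⟨a, ha⟩ := EuclideanDomain.gcd_dvd_left r s
  obtain ⟨b, hb⟩ := EuclideanDomain.gcd_dvd_right r s
  set g := EuclideanDomain.gcd r s with hg
  have hb0 : b ≠ 0 := by rintro rfl; exact hs0 (by rw [hb, mul_zero])
  have hgx : aeval x g ≠ 0 := by
    intro h
    rw [hb, map_mul, h, zero_mul] at hs
    exact hs rfl
  refine ⟨a, b, ?_, hb0, ?_⟩
  · refine ⟨EuclideanDomain.gcdA r s, EuclideanDomain.gcdB r s, ?_⟩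
    apply mul_left_cancel₀ h0
    have := EuclideanDomain.gcd_eq_gcd_ab r s
    rw [← hg] at this
    calc g * (EuclideanDomain.gcdA r s * a + EuclideanDomain.gcdB r s * b)
        = (g * a) * EuclideanDomain.gcdA r s + (g * b) * EuclideanDomain.gcdB r s := by ring
      _ = g := by rw [← ha, ← hb, ← this]
      _ = g * 1 := (mul_one g).symm
  · rw [ha, hb, map_mul, map_mul, mul_div_mul_left _ _ hgx]

/-- If a reduced fraction in `x ^ d` is a `k`-th power in `ℚ(x)`, then `k` divides `d` times the
degrees of its numerator and denominator. -/
theorem dvd_natDegree_of_div_eq_pow {x h : K} (hx : Transcendental ℚ x) {P Q : ℚ[X]}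
    (hPQ : IsCoprime P Q) (hQ : Q ≠ 0) {d k : ℕ} (hd : 0 < d) (hh : h ∈ ℚ⟮x⟯)
    (heq : aeval (x ^ d) P / aeval (x ^ d) Q = h ^ k) :
    k ∣ P.natDegree * d ∧ k ∣ Q.natDegree * d := by
  obtain ⟨A, B, hAB, hB, rfl⟩ := exists_isCoprime_of_mem_adjoin_simple hh
  have hinj := transcendental_iff_injective.1 hx
  rw [← expand_aeval, ← expand_aeval, div_pow, ← map_pow, ← map_pow, div_eq_div_iff, ← map_mul,
    ← map_mul] at heq
  · have hpoly := hinj heq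
    have hco : IsCoprime (expand ℚ d P) (expand ℚ d Q) := hPQ.map (expand ℚ d).toRingHom
    have hco' : IsCoprime (A ^ k) (B ^ k) := hAB.pow
    -- Both sides are reduced fractions, so cross-multiplying makes numerators and denominators
    -- agree up to units; comparing degrees then finishes.
    have h1 : Associated (expand ℚ d P) (A ^ k) := associated_of_dvd_dvd
      (hco.dvd_of_dvd_mul_right (Dvd.intro _ hpoly)) (hco'.dvd_of_dvd_mul_right (Dvd.intro _ hpoly.symm))
    have h2 : Associated (expand ℚ d Q) (B ^ k) := associated_of_dvd_dvd
      (hco.symm.dvd_of_dvd_mul_left (Dvd.intro_left _ hpoly.symm))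
      (hco'.symm.dvd_of_dvd_mul_left (Dvd.intro_left _ hpoly))
    have h1' := natDegree_eq_of_degree_eq (degree_eq_degree_of_associated h1)
    have h2' := natDegree_eq_of_degree_eq (degree_eq_degree_of_associated h2)
    rw [natDegree_expand, natDegree_pow] at h1' h2'
    exact ⟨h1' ▸ dvd_mul_right _ _, h2' ▸ dvd_mul_right _ _⟩
  · rw [Ne, map_eq_zero_iff _ hinj]
    exact (expand_ne_zero hd).2 hQ
  · rw [Ne, map_eq_zero_iff _ hinj]
    exact pow_ne_zero _ hB

end Degree

-- Isomorphisms of generated fields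

section Iso

variable {K : Type} [Field K] [Algebra ℚ K]

/-- The families `a` and `b` are locally given by the same powers of transcendental elements. -/
def LocallySamePowers {ι : Type} (a b : ι → K) : Prop :=
  ∀ A : Finset ι, ∃ (x y : K) (e : ι → ℕ), Transcendental ℚ x ∧ Transcendental ℚ y ∧
    ∀ i ∈ A, a i = x ^ e i ∧ b i = y ^ e i

theorem aeval_eq_aeval_X_pow {ι : Type} {a : ι → K} {P : MvPolynomial ι ℚ} {x : K} {e : ι → ℕ}
    (h : ∀ i ∈ P.vars, a i = x ^ e i) :
    MvPolynomial.aeval a P = aeval x (MvPolynomial.aeval (fun i => (X : ℚ[X]) ^ e i) P) := by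
  have h2 : MvPolynomial.aeval a P = MvPolynomial.aeval (fun i => x ^ e i) P :=
    MvPolynomial.eval₂Hom_congr' rfl (fun i hi _ => h i hi) rfl
  rw [h2, ← AlgHom.comp_apply, MvPolynomial.comp_aeval]
  simp

/-- A relation involves finitely many variables, so on either side it is the vanishing at a
transcendental element of the same one-variable polynomial, obtained from `X_i ↦ X ^ e i`. -/
theorem LocallySamePowers.ker_aeval_eq {ι : Type} {a b : ι → K} (h : LocallySamePowers a b) :
    RingHom.ker (MvPolynomial.aeval (R := ℚ) a) = RingHom.ker (MvPolynomial.aeval (R := ℚ) b) := by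
  ext P
  obtain ⟨x, y, e, hx, hy, hxy⟩ := h P.vars
  rw [RingHom.mem_ker, RingHom.mem_ker, aeval_eq_aeval_X_pow fun i hi => (hxy i hi).1,
    aeval_eq_aeval_X_pow fun i hi => (hxy i hi).2,
    map_eq_zero_iff _ (transcendental_iff_injective.1 hx),
    map_eq_zero_iff _ (transcendental_iff_injective.1 hy)]

-- Equal relation ideals identify the generated algebras, and the identification extends to their
-- fraction fields.
open IntermediateField.algebraAdjoinAdjoin in
theorem LocallySamePowers.exists_ringEquiv {ι : Type} {a b : ι → K} (h : LocallySamePowers a b) :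
    ∃ e : adjoin ℚ (Set.range a) ≃+* adjoin ℚ (Set.range b),
      ∀ i, e ⟨a i, subset_adjoin ℚ _ (Set.mem_range_self i)⟩ =
        ⟨b i, subset_adjoin ℚ _ (Set.mem_range_self i)⟩ := by
  let e₁ (c : ι → K) : (MvPolynomial ι ℚ ⧸ RingHom.ker (MvPolynomial.aeval (R := ℚ) c)) ≃ₐ[ℚ]
      Algebra.adjoin ℚ (Set.range c) :=
    (Ideal.quotientKerEquivRange (MvPolynomial.aeval (R := ℚ) c)).trans
      (Subalgebra.equivOfEq _ _ (Algebra.adjoin_range_eq_range_aeval ℚ c).symm)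
  have he₁ (c : ι → K) (i : ι) : e₁ c (Ideal.Quotient.mk _ (MvPolynomial.X i)) =
      ⟨c i, Algebra.subset_adjoin (Set.mem_range_self i)⟩ := by
    exact Subtype.ext (MvPolynomial.aeval_X c i)
  let e₂ : Algebra.adjoin ℚ (Set.range a) ≃ₐ[ℚ] Algebra.adjoin ℚ (Set.range b) :=
    ((e₁ a).symm.trans (Ideal.quotientEquivAlgOfEq ℚ h.ker_aeval_eq)).trans (e₁ b)
  have he₂ (i : ι) : e₂ ⟨a i, Algebra.subset_adjoin (Set.mem_range_self i)⟩ =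
      ⟨b i, Algebra.subset_adjoin (Set.mem_range_self i)⟩ := by
    rw [← he₁ a, ← he₁ b]
    simp [e₂]
  refine ⟨(IsFractionRing.ringEquivOfRingEquiv (K := adjoin ℚ (Set.range a))
    (L := adjoin ℚ (Set.range b)) e₂.toRingEquiv), fun i => ?_⟩
  have := IsFractionRing.ringEquivOfRingEquiv_algebraMap (K := adjoin ℚ (Set.range a))
    (L := adjoin ℚ (Set.range b)) e₂.toRingEquiv ⟨a i, Algebra.subset_adjoin (Set.mem_range_self i)⟩
  refine this.trans ?_
  apply Subtype.ext
  change ((e₂ _ : Algebra.adjoin ℚ (Set.range b)) : K) = b i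
  rw [he₂]

end Iso

-- The fields generated by `t` (index `1`) and some of its roots

section RootFields

/-- The set of odd primes. -/
def oddPrimes : Set ℕ := {p | p.Prime ∧ p ≠ 2}

theorem coprime_of_mem_insert_oddPrimes {p q : ℕ} (hp : p ∈ insert 1 oddPrimes)
    (hq : q ∈ insert 1 oddPrimes) (hpq : p ≠ q) : Nat.Coprime p q := by
  rcases hp with rfl | hp
  · exact Nat.coprime_one_left q
  rcases hq with rfl | hq
  · exact Nat.coprime_one_right p
  exact (Nat.coprime_primes hp.1 hq.1).2 hpq

theorem pos_of_mem_insert_oddPrimes {p : ℕ} (hp : p ∈ insert 1 oddPrimes) : 0 < p := by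
  rcases hp with rfl | hp
  · exact one_pos
  · exact hp.1.pos

theorem coprime_prod_of_notMem {C : Finset ℕ} (hC : (C : Set ℕ) ⊆ insert 1 oddPrimes) {q : ℕ}
    (hq : q ∈ oddPrimes) (hqC : q ∉ C) : Nat.Coprime q (∏ p ∈ C, p) :=
  Nat.Coprime.prod_right fun p hp =>
    coprime_of_mem_insert_oddPrimes (Set.mem_insert_of_mem _ hq) (hC hp)
      (by rintro rfl; exact hqC hp)

variable {K : Type} [Field K] [Algebra ℚ K]

/-- The field generated by `ρ 1` and the `ρ p`, `p ∈ R`. -/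
def rootField (ρ : ℕ → K) (R : Set ℕ) : IntermediateField ℚ K :=
  adjoin ℚ (Set.range fun i : ↥(insert 1 R) => ρ i)

theorem mem_rootField {ρ : ℕ → K} {R : Set ℕ} {p : ℕ} (hp : p ∈ insert 1 R) :
    ρ p ∈ rootField ρ R :=
  subset_adjoin ℚ _ ⟨⟨p, hp⟩, rfl⟩

theorem rootField_le {ρ : ℕ → K} {R : Set ℕ} {E : IntermediateField ℚ K}
    (h : ∀ p ∈ insert 1 R, ρ p ∈ E) : rootField ρ R ≤ E := by
  refine adjoin_le_iff.2 ?_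
  rintro _ ⟨⟨p, hp⟩, rfl⟩
  exact h p hp

theorem rootField_mono {ρ : ℕ → K} {R R' : Set ℕ} (h : R ⊆ R') :
    rootField ρ R ≤ rootField ρ R' :=
  rootField_le fun _ hp => mem_rootField (Set.insert_subset_insert h hp)

theorem exists_finset_of_mem_rootField {ρ : ℕ → K} {R : Set ℕ} {y : K}
    (hy : y ∈ rootField ρ R) : ∃ A : Finset ℕ, (A : Set ℕ) ⊆ R ∧ y ∈ rootField ρ A := by
  classical
  obtain ⟨T, hT, hyT⟩ := exists_finset_of_mem_adjoin hy
  rw [← Set.image_eq_range, Finset.subset_set_image_iff] at hT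
  obtain ⟨A, hA, rfl⟩ := hT
  refine ⟨A.erase 1, fun p hp => ?_, ?_⟩
  · obtain ⟨hp1, hpA⟩ := Finset.mem_erase.1 hp
    exact (hA hpA).resolve_left hp1
  · refine adjoin_le_iff.2 ?_ hyT
    rintro _ hz
    obtain ⟨p, hp, rfl⟩ := Finset.mem_image.1 hz
    refine mem_rootField ?_
    by_cases h1 : p = 1
    · exact Or.inl h1
    · exact Or.inr (Finset.mem_erase.2 ⟨h1, hp⟩)

theorem exists_finset_of_subset_rootField {ρ : ℕ → K} {R : Set ℕ} {S : Set K} (hS : S.Finite)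
    (h : S ⊆ rootField ρ R) : ∃ A : Finset ℕ, (A : Set ℕ) ⊆ R ∧ S ⊆ rootField ρ A := by
  classical
  induction S, hS using Set.Finite.induction_on with
  | empty => exact ⟨∅, by simp, Set.empty_subset _⟩
  | insert _ _ ih =>
    obtain ⟨A, hA, hSA⟩ := ih ((Set.subset_insert _ _).trans h)
    obtain ⟨B, hB, hyB⟩ := exists_finset_of_mem_rootField (h (Set.mem_insert _ _))
    refine ⟨A ∪ B, by simp [hA, hB], Set.insert_subset ?_ (hSA.trans ?_)⟩
    · exact rootField_mono (by simp) hyB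
    · exact rootField_mono (by simp)

/-- `ρ p` is a `p`-th root of `t` for `p = 1` and all odd primes `p`. -/
def IsRootSystem (t : K) (ρ : ℕ → K) : Prop :=
  ∀ p ∈ insert 1 oddPrimes, ρ p ^ p = t

variable {t : K} {ρ : ℕ → K}

omit [Algebra ℚ K] in
theorem IsRootSystem.apply_one (h : IsRootSystem t ρ) : ρ 1 = t := by
  rw [← h 1 (Set.mem_insert _ _), pow_one]

theorem Transcendental.of_pow_eq {x t : K} (ht : Transcendental ℚ t) {n : ℕ} (h : x ^ n = t) :
    Transcendental ℚ x := fun hx => ht (h ▸ hx.pow n)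

theorem Transcendental.pow_pos {t : K} (ht : Transcendental ℚ t) {n : ℕ} (hn : 0 < n) :
    Transcendental ℚ (t ^ n) := fun h => ht (h.of_pow hn)

/-- This refines a root `x` already chosen for the indices `C` to one that also accounts for `D`;
disjointness supplies the coprimality of the orders. -/
theorem IsRootSystem.exists_common_root_over (h : IsRootSystem t ρ) (ht : Transcendental ℚ t)
    {C D : Finset ℕ} (hC : (C : Set ℕ) ⊆ insert 1 oddPrimes)
    (hD : (D : Set ℕ) ⊆ insert 1 oddPrimes) (hCD : Disjoint C D) {x : K}
    (hx : x ^ (∏ p ∈ C, p) = t) :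
    ∃ y : K, y ^ (∏ p ∈ D, p) = x ∧
      ∀ p ∈ D, y ^ ((∏ p ∈ C, p) * ∏ q ∈ D.erase p, q) = ρ p :=
  _root_.exists_common_root (fun h0 => ht (by rw [h0]; exact isAlgebraic_zero))
    (Finset.prod_pos fun _ hp => pos_of_mem_insert_oddPrimes (hC hp)) hx D
    (fun p hp => h p (hD hp))
    (fun _ hp => Nat.Coprime.prod_left fun _ hq => coprime_of_mem_insert_oddPrimes (hC hq) (hD hp)
      (Finset.disjoint_left.1 hCD hq |> fun hn e => hn (e ▸ hp)))
    (fun _ hp => pos_of_mem_insert_oddPrimes (hD hp))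
    (fun _ hp _ hq hpq => coprime_of_mem_insert_oddPrimes (hD hp) (hD hq) hpq)

theorem IsRootSystem.exists_common_root (h : IsRootSystem t ρ) (ht : Transcendental ℚ t)
    {C : Finset ℕ} (hC : (C : Set ℕ) ⊆ insert 1 oddPrimes) :
    ∃ y : K, y ^ (∏ p ∈ C, p) = t ∧ ∀ p ∈ C, y ^ (∏ q ∈ C.erase p, q) = ρ p := by
  obtain ⟨y, h1, h2⟩ := h.exists_common_root_over ht (C := ∅) (by simp) hC
    (Finset.disjoint_empty_left _) (x := t) (by simp)
  exact ⟨y, h1, by simpa using h2⟩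

theorem IsRootSystem.locallySamePowers {s : K} {ρ' : ℕ → K} (h : IsRootSystem t ρ)
    (ht : Transcendental ℚ t) (h' : IsRootSystem s ρ') (hs : Transcendental ℚ s) {R : Set ℕ}
    (hR : R ⊆ oddPrimes) :
    LocallySamePowers (fun i : ↥(insert 1 R) => ρ i) (fun i : ↥(insert 1 R) => ρ' i) := by
  intro A
  have hC : ((A.image Subtype.val : Finset ℕ) : Set ℕ) ⊆ insert 1 oddPrimes := by
    intro p hp
    obtain ⟨i, -, rfl⟩ := Finset.mem_image.1 hp
    exact Set.insert_subset_insert hR i.2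
  obtain ⟨x, hxt, hx⟩ := h.exists_common_root ht hC
  obtain ⟨y, hys, hy⟩ := h'.exists_common_root hs hC
  exact ⟨x, y, fun i => ∏ q ∈ (A.image Subtype.val).erase i.1, q, ht.of_pow_eq hxt,
    hs.of_pow_eq hys, fun i hi => ⟨(hx i (Finset.mem_image_of_mem _ hi)).symm,
      (hy i (Finset.mem_image_of_mem _ hi)).symm⟩⟩

/-- Omitting one of the generating roots gives an isomorphic field. -/
theorem IsRootSystem.exists_ringEquiv_diff_singleton (h : IsRootSystem t ρ)
    (ht : Transcendental ℚ t) {R : Set ℕ} (hR : R ⊆ oddPrimes) {q : ℕ} (hq : q ∈ R) :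
    ∃ e : rootField ρ R ≃+* rootField ρ (R \ {q}),
      (e ⟨ρ q, mem_rootField (Set.mem_insert_of_mem _ hq)⟩ : K) = t := by
  -- A root system for `t ^ q`, whose `q`-th root is `t` itself. It generates the field without `ρ
  -- q`: each other `ρ p` is recovered from `ρ p ^ p = t` and `ρ p ^ q` by coprimality.
  set ρ' : ℕ → K := fun p => if p = q then t else ρ p ^ q with hρ'
  have hq1 : q ≠ 1 := (hR hq).1.ne_one
  have h' : IsRootSystem (t ^ q) ρ' := by
    intro p hp
    by_cases hpq : p = q
    · simp [hρ', hpq]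
    · simp only [hρ', if_neg hpq]
      rw [← pow_mul, mul_comm, pow_mul, h p hp]
  have heq : rootField ρ' R = rootField ρ (R \ {q}) := by
    apply le_antisymm
    · refine rootField_le fun p hp => ?_
      by_cases hpq : p = q
      · simp only [hρ', if_pos hpq]
        rw [← h.apply_one]
        exact mem_rootField (Set.mem_insert _ _)
      · simp only [hρ', if_neg hpq]
        refine pow_mem (mem_rootField ?_) q
        exact hp.imp id fun hp => ⟨hp, hpq⟩
    · have htE : t ∈ rootField ρ' R := by
        have := mem_rootField (ρ := ρ') (Set.mem_insert_of_mem 1 hq)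
        simpa only [hρ', if_pos] using this
      refine rootField_le fun p hp => ?_
      have hp' : p ∈ insert 1 R := hp.imp id And.left
      have hpq : p ≠ q := by
        rcases hp with rfl | hp
        · exact hq1.symm
        · exact hp.2
      have hpO : p ∈ insert 1 oddPrimes := Set.insert_subset_insert hR hp'
      refine IntermediateField.mem_of_pow_mem_of_coprime _ (m := p) (n := q)
        (coprime_of_mem_insert_oddPrimes hpO (Or.inr (hR hq)) hpq) ?_ ?_
      · rwa [h p hpO]
      · have := mem_rootField (ρ := ρ') hp'
        simpa only [hρ', if_neg hpq] using this
  obtain ⟨e₀, he₀⟩ : ∃ e₀ : rootField ρ' R ≃+* rootField ρ (R \ {q}), ∀ x, (e₀ x : K) = x := by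
    rw [heq]
    exact ⟨RingEquiv.refl _, fun _ => rfl⟩
  obtain ⟨e, he⟩ := (h.locallySamePowers ht h' (ht.pow_pos (hR hq).1.pos) hR).exists_ringEquiv
  refine ⟨e.trans e₀, (he₀ _).trans ?_⟩
  have := congrArg Subtype.val (he ⟨q, Set.mem_insert_of_mem 1 hq⟩)
  exact this.trans (if_pos rfl)

theorem IsRootSystem.nonempty_ringEquiv_diff_finset (h : IsRootSystem t ρ)
    (ht : Transcendental ℚ t) (B : Finset ℕ) :
    Nonempty (rootField ρ oddPrimes ≃+* rootField ρ (oddPrimes \ B)) := by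
  induction B using Finset.induction_on with
  | empty =>
    rw [Finset.coe_empty, Set.sdiff_empty]
    exact ⟨RingEquiv.refl _⟩
  | insert q B hq ih =>
    obtain ⟨e⟩ := ih
    by_cases hqO : q ∈ oddPrimes
    · obtain ⟨e', -⟩ := h.exists_ringEquiv_diff_singleton ht
        (Set.sdiff_subset (s := oddPrimes) (t := B)) ⟨hqO, hq⟩
      rw [Set.sdiff_sdiff, Set.union_singleton, ← Finset.coe_insert] at e'
      exact ⟨e.trans e'⟩
    · have : oddPrimes \ ((insert q B : Finset ℕ) : Set ℕ) = oddPrimes \ B := by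
        ext p
        simp only [Set.mem_sdiff, Finset.coe_insert, Set.mem_insert_iff]
        constructor
        · rintro ⟨h1, h2⟩
          exact ⟨h1, fun h => h2 (Or.inr h)⟩
        · rintro ⟨h1, h2⟩
          refine ⟨h1, ?_⟩
          rintro (rfl | h)
          · exact hqO h1
          · exact h2 h
      rw [this]
      exact ⟨e⟩

/-- Inside a single `ℚ(x)`, `ρ q` is `x ^ d` with `d` a product of primes other than `q` (and
possibly `1`), so `q ∤ d` and it is no `q`-th power. -/
theorem IsRootSystem.pow_ne (h : IsRootSystem t ρ) (ht : Transcendental ℚ t) {q : ℕ}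
    (hq : q ∈ oddPrimes) {y : K} (hy : y ∈ rootField ρ oddPrimes) : y ^ q ≠ ρ q := by
  classical
  intro hyq
  obtain ⟨A, hA, hyA⟩ := exists_finset_of_mem_rootField hy
  have hC : ((insert 1 (insert q A) : Finset ℕ) : Set ℕ) ⊆ insert 1 oddPrimes := by
    rw [Finset.coe_insert, Finset.coe_insert]
    exact Set.insert_subset_insert (Set.insert_subset hq hA)
  obtain ⟨x, hxt, hx⟩ := h.exists_common_root ht hC
  have hyx : y ∈ ℚ⟮x⟯ := by
    refine rootField_le (fun p hp => ?_) hyA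
    rw [← hx p (by simpa using hp.imp id Or.inr)]
    exact pow_mem (mem_adjoin_simple_self ℚ x) _
  set C : Finset ℕ := insert 1 (insert q A) with hCdef
  have hqC : q ∈ C := by simp [hCdef]
  have hC' : ((C.erase q : Finset ℕ) : Set ℕ) ⊆ insert 1 oddPrimes :=
    (Finset.coe_subset.2 (Finset.erase_subset _ _)).trans hC
  have hdvd := (dvd_natDegree_of_div_eq_pow (ht.of_pow_eq hxt) (P := X) (Q := 1)
    isCoprime_one_right one_ne_zero (k := q) (d := ∏ p ∈ C.erase q, p)
    (Finset.prod_pos fun p hp => pos_of_mem_insert_oddPrimes (hC' hp)) hyx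
    (by simp [hyq, hx q hqC])).1
  rw [natDegree_X, one_mul] at hdvd
  have hcop := coprime_prod_of_notMem hC' hq (Finset.notMem_erase _ _)
  exact hq.1.ne_one (Nat.Coprime.eq_one_of_dvd hcop hdvd)

/-- If infinitely many odd primes are missing in `R`, no transcendental element of `rootField ρ R`
has roots of all odd prime orders there. -/
theorem IsRootSystem.isAlgebraic_of_forall_exists_pow_eq (h : IsRootSystem t ρ)
    (ht : Transcendental ℚ t) {R : Set ℕ} (hR : R ⊆ oddPrimes)
    (hinf : ∀ n : ℕ, ∃ p ∈ oddPrimes, n < p ∧ p ∉ R) {w : K} (hw : w ∈ rootField ρ R)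
    (hroot : ∀ p ∈ oddPrimes, ∃ y ∈ rootField ρ R, y ^ p = w) : IsAlgebraic ℚ w := by
  classical
  obtain ⟨A, hA, hwA⟩ := exists_finset_of_mem_rootField hw
  have hC : ((insert 1 A : Finset ℕ) : Set ℕ) ⊆ insert 1 oddPrimes := by
    rw [Finset.coe_insert]
    exact Set.insert_subset_insert (hA.trans hR)
  obtain ⟨x, hxt, hx⟩ := h.exists_common_root ht hC
  have hwx : w ∈ ℚ⟮x⟯ := by
    refine rootField_le (fun p hp => ?_) hwA
    rw [← hx p (by simpa using hp)]
    exact pow_mem (mem_adjoin_simple_self ℚ x) _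
  obtain ⟨P, Q, hPQ, hQ, hwPQ⟩ := exists_isCoprime_of_mem_adjoin_simple hwx
  -- The prime exceeds both degrees and is missing from `R`. Adjoining further roots from `R`
  -- replaces `x` by `z ^ d` with `d` prime to `p`, so `p` must divide the degrees themselves,
  -- forcing them to be zero.
  obtain ⟨p, hpO, hpn, hpR⟩ := hinf (max P.natDegree Q.natDegree)
  obtain ⟨y, hy, hyw⟩ := hroot p hpO
  obtain ⟨A', hA', hyA'⟩ := exists_finset_of_mem_rootField hy
  set C : Finset ℕ := insert 1 A with hCdef
  have hD : ((A' \ C : Finset ℕ) : Set ℕ) ⊆ R :=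
    (Finset.coe_subset.2 Finset.sdiff_subset).trans hA'
  have hD' : ((A' \ C : Finset ℕ) : Set ℕ) ⊆ insert 1 oddPrimes :=
    (hD.trans hR).trans (Set.subset_insert _ _)
  obtain ⟨z, hzx, hz⟩ := h.exists_common_root_over ht hC hD' Finset.disjoint_sdiff hxt
  have hyz : y ∈ ℚ⟮z⟯ := by
    refine rootField_le (fun r hr => ?_) hyA'
    by_cases hrC : r ∈ C
    · rw [← hx r hrC, ← hzx]
      exact pow_mem (pow_mem (mem_adjoin_simple_self ℚ z) _) _
    · have hr' : r ∈ A' \ C := by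
        refine Finset.mem_sdiff.2 ⟨?_, hrC⟩
        refine Or.resolve_left hr ?_
        rintro rfl
        exact hrC (Finset.mem_insert_self _ _)
      rw [← hz r hr']
      exact pow_mem (mem_adjoin_simple_self ℚ z) _
  have hpD : Nat.Coprime p (∏ r ∈ A' \ C, r) :=
    coprime_prod_of_notMem hD' hpO fun hp => hpR (hD hp)
  obtain ⟨h1, h2⟩ := dvd_natDegree_of_div_eq_pow ((ht.of_pow_eq hxt).of_pow_eq hzx) hPQ hQ
    (d := ∏ r ∈ A' \ C, r)
    (Finset.prod_pos fun p hp => pos_of_mem_insert_oddPrimes (hD' hp)) hyz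
    (by rw [hzx, hyw, hwPQ])
  have hP0 : P.natDegree = 0 := Nat.eq_zero_of_dvd_of_lt (hpD.dvd_of_dvd_mul_right h1)
    ((le_max_left _ _).trans_lt hpn)
  have hQ0 : Q.natDegree = 0 := Nat.eq_zero_of_dvd_of_lt (hpD.dvd_of_dvd_mul_right h2)
    ((le_max_right _ _).trans_lt hpn)
  rw [hwPQ, eq_C_of_natDegree_eq_zero hP0, eq_C_of_natDegree_eq_zero hQ0, aeval_C, aeval_C,
    ← map_div₀]
  exact isAlgebraic_algebraMap _

end RootFields

-- `Σ₂` formulas at `t`, and the generic set of primes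

section Generic

variable {K : Type} [Field K] [Algebra ℚ K] {t : K} {ρ : ℕ → K}

/-- The inclusion between intermediate fields as a ring homomorphism. -/
def IntermediateField.inclusionRingHom {E E' : IntermediateField ℚ K} (h : E ≤ E') : E →+* E' where
  toFun x := ⟨x, h x.2⟩
  map_one' := rfl
  map_mul' _ _ := rfl
  map_zero' := rfl
  map_add' _ _ := rfl

theorem IntermediateField.coe_inclusionRingHom {E E' : IntermediateField ℚ K} (h : E ≤ E')
    (x : E) : (inclusionRingHom h x : K) = x :=
  rfl

theorem IntermediateField.mem_range_inclusionRingHom {E E' : IntermediateField ℚ K} (h : E ≤ E')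
    {x : E'} (hx : (x : K) ∈ E) : x ∈ Set.range (inclusionRingHom h) :=
  ⟨⟨x, hx⟩, rfl⟩

/-- A rational polynomial vanishing at `f x` already vanishes at `x`, by injectivity. This lets an
abstract isomorphism be compared with the inclusion in `K`. -/
theorem IsAlgebraic.of_ringHom_apply {E : Type} [Field E] [CharZero E] (f g : E →+* K) {x : E}
    (h : IsAlgebraic ℚ (f x)) : IsAlgebraic ℚ (g x) := by
  obtain ⟨p, hp, hpx⟩ := h
  refine ⟨p, hp, ?_⟩
  rw [aeval_def] at hpx ⊢
  have hx : p.eval₂ (Rat.castHom E) x = 0 := by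
    apply f.injective
    rw [hom_eval₂, map_zero, ← hpx]
    congr 1
    exact Subsingleton.elim _ _
  have := congrArg g hx
  rw [hom_eval₂, map_zero] at this
  rw [← this]
  congr 1
  exact Subsingleton.elim _ _

theorem exists_oddPrime_notMem (A : Finset ℕ) (n : ℕ) : ∃ p ∈ oddPrimes, n < p ∧ p ∉ A := by
  obtain ⟨p, hpn, hp⟩ := Nat.exists_infinite_primes (n + A.sum id + 3)
  refine ⟨p, ⟨hp, by omega⟩, by omega, fun hpA => ?_⟩
  have : p ≤ A.sum id := Finset.single_le_sum (f := id) (fun _ _ => Nat.zero_le _) hpA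
  omega

/-- A `Σ₂` formula true of `t` is true of some `ρ q`. -/
theorem IsRootSystem.exists_realize_root (h : IsRootSystem t ρ) (ht : Transcendental ℚ t)
    {φ : InfFormula fieldLang 1} (hφ : φ.IsSigma 2) {τ : rootField ρ oddPrimes} (hτ : (τ : K) = t)
    (hr : φ.Realize fun _ : Fin 1 => τ) :
    ∃ q, ∃ hq : q ∈ oddPrimes,
      φ.Realize fun _ : Fin 1 =>
        (⟨ρ q, mem_rootField (Set.mem_insert_of_mem _ hq)⟩ : rootField ρ oddPrimes) := by
  obtain ⟨S, hSfin, hS⟩ := hφ.exists_finite_witness le_rfl _ hr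
  obtain ⟨A, hA, hSA⟩ := exists_finset_of_subset_rootField (ρ := ρ) (R := oddPrimes)
    (hSfin.image Subtype.val) (by rintro _ ⟨x, -, rfl⟩; exact x.2)
  obtain ⟨q, hq, -, hqA⟩ := exists_oddPrime_notMem A 0
  obtain ⟨e, he⟩ := h.exists_ringEquiv_diff_singleton ht subset_rfl hq
  -- This self-embedding of the field sends `ρ q` to `t`, and its range, the field without `ρ q`,
  -- still contains the witnesses; so truth at `t` pulls back to truth at `ρ q`.
  refine ⟨q, hq, hS _ ((inclusionRingHom (rootField_mono Set.sdiff_subset)).comp e.toRingHom) _ ?_ ?_⟩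
  · intro x hx
    have hx' : (x : K) ∈ rootField ρ (oddPrimes \ {q}) := by
      have hAq : (A : Set ℕ) ⊆ oddPrimes \ {q} := fun p hp =>
        ⟨hA hp, fun hpq => hqA (Set.mem_singleton_iff.1 hpq ▸ hp)⟩
      exact rootField_mono hAq (hSA (Set.mem_image_of_mem _ hx))
    obtain ⟨y, hy⟩ := mem_range_inclusionRingHom (rootField_mono Set.sdiff_subset) hx'
    refine ⟨e.symm y, ?_⟩
    rw [RingHom.comp_apply, ← hy]
    exact congrArg (inclusionRingHom _) (e.apply_symm_apply y)
  · funext i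
    apply Subtype.ext
    rw [hτ, Function.comp_apply, RingHom.comp_apply, coe_inclusionRingHom]
    exact he

/-- A `Σ₂` formula true of all tuples of `rootField ρ oddPrimes` can be made true of a given tuple
in all `rootField ρ R` by finitely many conditions on `R`. -/
theorem IsRootSystem.exists_finset_forces (h : IsRootSystem t ρ) (ht : Transcendental ℚ t)
    {k n : ℕ} {ψ : InfFormula fieldLang n} (hψ : ψ.IsSigma k) (hk : k ≤ 2)
    (hF : ∀ u : Fin n → rootField ρ oddPrimes, ψ.Realize u) (B : Finset ℕ) (u : Fin n → K) :
    ∃ A : Finset ℕ, (A : Set ℕ) ⊆ oddPrimes \ B ∧ ∀ R : Set ℕ, (A : Set ℕ) ⊆ R →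
      R ⊆ oddPrimes \ B → ∀ u' : Fin n → rootField ρ R, (∀ l, (u' l : K) = u l) →
        ψ.Realize u' := by
  by_cases hu : ∀ l, u l ∈ rootField ρ (oddPrimes \ B)
  · obtain ⟨e⟩ := h.nonempty_ringEquiv_diff_finset ht B
    set v : Fin n → rootField ρ (oddPrimes \ B) := fun l => ⟨u l, hu l⟩ with hv
    have hr : ψ.Realize v := by
      have := hψ.realize_comp_equiv hk e.symm _ (hF (e.symm ∘ v))
      convert this using 1
      funext l
      simp
    obtain ⟨S, hSfin, hS⟩ := hψ.exists_finite_witness hk _ hr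
    obtain ⟨A, hA, hSA⟩ := exists_finset_of_subset_rootField (ρ := ρ) (R := oddPrimes \ B)
      (hSfin.image Subtype.val) (by rintro _ ⟨x, -, rfl⟩; exact x.2)
    refine ⟨A, hA, fun R hAR hRB u' hu' => ?_⟩
    refine hS _ (inclusionRingHom (rootField_mono hRB)) u' (fun x hx => ?_) ?_
    · exact mem_range_inclusionRingHom _ (rootField_mono hAR (hSA (Set.mem_image_of_mem _ hx)))
    · funext l
      apply Subtype.ext
      rw [Function.comp_apply, coe_inclusionRingHom, hu' l]
  -- If `u` is not a tuple of the largest permitted field, no permitted `R` captures it and nothing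
  -- has to be secured.
  · refine ⟨∅, by simp, fun R _ hRB u' hu' => absurd (fun l => ?_) hu⟩
    rw [← hu' l]
    exact rootField_mono hRB (u' l).2

/-- Finite conditions on a set `R` of odd primes: primes that belong to `R` and numbers that
do not. -/
def FinCond : Type :=
  {c : Finset ℕ × Finset ℕ // (c.1 : Set ℕ) ⊆ oddPrimes \ c.2}

instance : Preorder FinCond := inferInstanceAs (Preorder (Subtype _))

/-- `c` forces `ψ` at `u`: it makes `ψ` true of `u` in all fields `rootField ρ R` with `R`
satisfying `c`. -/
def FinCond.Forces (ρ : ℕ → K) {n : ℕ} (ψ : InfFormula fieldLang n) (u : Fin n → K)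
    (c : FinCond) : Prop :=
  ∀ R : Set ℕ, (c.1.1 : Set ℕ) ⊆ R → R ⊆ oddPrimes \ c.1.2 →
    ∀ u' : Fin n → rootField ρ R, (∀ l, (u' l : K) = u l) → ψ.Realize u'

/-- The exclusions already made are kept; only finitely many required primes are added. -/
theorem IsRootSystem.isCofinal_forces (h : IsRootSystem t ρ) (ht : Transcendental ℚ t)
    {k n : ℕ} {ψ : InfFormula fieldLang n} (hψ : ψ.IsSigma k) (hk : k ≤ 2)
    (hF : ∀ u : Fin n → rootField ρ oddPrimes, ψ.Realize u) (u : Fin n → K) :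
    IsCofinal {c : FinCond | c.Forces ρ ψ u} := by
  classical
  rintro ⟨⟨A, B⟩, hAB⟩
  obtain ⟨A', hA', hf⟩ := h.exists_finset_forces ht hψ hk hF B u
  refine ⟨⟨(A ∪ A', B), ?_⟩, ?_, ?_⟩
  · rw [Finset.coe_union]
    exact Set.union_subset hAB hA'
  · intro R hR hRB u' hu'
    rw [Finset.coe_union] at hR
    exact hf R (Set.subset_union_right.trans hR) hRB u' hu'
  · exact Prod.mk_le_mk.2 ⟨Finset.subset_union_left, le_rfl⟩

/-- A large prime not yet required can always be excluded; doing so for every `n` makes the generic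
set coinfinite. -/
theorem FinCond.isCofinal_excludes (n : ℕ) :
    IsCofinal {c : FinCond | ∃ p ∈ oddPrimes, n < p ∧ p ∈ c.1.2} := by
  rintro ⟨⟨A, B⟩, hAB⟩
  obtain ⟨p, hp, hnp, hpA⟩ := exists_oddPrime_notMem A n
  refine ⟨⟨(A, insert p B), ?_⟩, ⟨p, hp, hnp, Finset.mem_insert_self _ _⟩, ?_⟩
  · intro q hq
    refine ⟨(hAB hq).1, fun hqB => ?_⟩
    rcases Finset.mem_insert.1 hqB with rfl | hqB
    · exact hpA hq
    · exact (hAB hq).2 hqB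
  · exact Prod.mk_le_mk.2 ⟨le_rfl, Finset.subset_insert _ _⟩

/-- A `Π₃` sentence true in `rootField ρ oddPrimes` is true in `rootField ρ R` for some `R` that
omits infinitely many odd primes. -/
theorem IsRootSystem.exists_realize_coinfinite (h : IsRootSystem t ρ) (ht : Transcendental ℚ t)
    [Countable (rootField ρ oddPrimes)] {φ : InfFormula fieldLang 0} (hφ : φ.IsPi 3)
    (hr : φ.Realize (M := rootField ρ oddPrimes) Fin.elim0) :
    ∃ R ⊆ oddPrimes, (∀ n : ℕ, ∃ p ∈ oddPrimes, n < p ∧ p ∉ R) ∧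
      φ.Realize (M := rootField ρ R) Fin.elim0 := by
  classical
  cases hφ with
  | conj j m ψ hj hψ =>
  have hF (i : ℕ) (u : Fin (0 + m i) → rootField ρ oddPrimes) : (ψ i).Realize u := by
    have := (InfFormula.realize_alls _ _ _).1 (hr i) (u ∘ Fin.natAdd 0)
    convert this using 1
    funext l
    refine Fin.addCases (fun l => l.elim0) (fun l => ?_) l
    rw [Fin.append_right]
    rfl
  -- As `R` is not known yet, the requirements range over all tuples of the full field; they are
  -- countably many, so one ideal meets them all.
  let D : (Σ i, (Fin (0 + m i) → rootField ρ oddPrimes)) ⊕ ℕ → Order.Cofinal FinCond :=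
    Sum.elim
      (fun s => ⟨_, h.isCofinal_forces ht (hψ s.1) (Nat.le_of_lt_succ (hj s.1)) (hF s.1)
        (fun l => s.2 l)⟩)
      (fun n => ⟨_, FinCond.isCofinal_excludes n⟩)
  let _ := Encodable.ofCountable ((Σ i, (Fin (0 + m i) → rootField ρ oddPrimes)) ⊕ ℕ)
  let I := Order.idealOfCofinals (⟨(∅, ∅), by simp⟩ : FinCond) D
  let R : Set ℕ := {p | ∃ c ∈ I, p ∈ c.1.1}
  have hRB (c : FinCond) (hc : c ∈ I) : R ⊆ oddPrimes \ c.1.2 := by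
    rintro p ⟨d, hd, hpd⟩
    obtain ⟨b, hb, hcb, hdb⟩ := I.directed c hc d hd
    have hp := b.2 (hdb.1 hpd)
    exact ⟨hp.1, fun hpc => hp.2 (hcb.2 hpc)⟩
  have hRO : R ⊆ oddPrimes := by
    rintro p ⟨c, -, hp⟩
    exact (c.2 hp).1
  refine ⟨R, hRO, fun n => ?_, fun i => ?_⟩
  · obtain ⟨c, ⟨p, hp, hnp, hpc⟩, hc⟩ := Order.cofinal_meets_idealOfCofinals _ D (Sum.inr n)
    exact ⟨p, hp, hnp, fun hpR => (hRB c hc hpR).2 hpc⟩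
  · rw [InfFormula.realize_alls]
    intro w
    obtain ⟨c, hfc, hc⟩ := Order.cofinal_meets_idealOfCofinals
      (⟨(∅, ∅), by simp⟩ : FinCond) D (Sum.inl ⟨i, fun l =>
        inclusionRingHom (rootField_mono hRO) (Fin.append Fin.elim0 w l)⟩)
    exact hfc R (fun p hp => ⟨c, hc, hp⟩) (hRB c hc) _
      (fun l => (coe_inclusionRingHom (rootField_mono hRO) _).symm)

/-- Fields with infinitely many odd primes omitted are not isomorphic to the whole field. -/
theorem IsRootSystem.isEmpty_ringEquiv (h : IsRootSystem t ρ) (ht : Transcendental ℚ t)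
    {R : Set ℕ} (hR : R ⊆ oddPrimes) (hinf : ∀ n : ℕ, ∃ p ∈ oddPrimes, n < p ∧ p ∉ R) :
    IsEmpty (rootField ρ oddPrimes ≃+* rootField ρ R) := by
  refine ⟨fun e => ?_⟩
  set τ : rootField ρ oddPrimes := ⟨t, h.apply_one ▸ mem_rootField (Set.mem_insert _ _)⟩ with hτ
  let f : rootField ρ oddPrimes →+* K := ((rootField ρ R).val : _ →+* K).comp e.toRingHom
  -- The image of `t` would have roots of all odd prime orders in the smaller field, hence be
  -- algebraic, and then so would `t`.
  refine ht (IsAlgebraic.of_ringHom_apply f ((rootField ρ oddPrimes).val : _ →+* K) (x := τ) ?_)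
  refine h.isAlgebraic_of_forall_exists_pow_eq ht hR hinf (e τ).2 fun p hp => ?_
  have hp' : p ∈ insert 1 oddPrimes := Set.mem_insert_of_mem _ hp
  refine ⟨_, (e ⟨ρ p, mem_rootField hp'⟩).2, ?_⟩
  have hpow : (⟨ρ p, mem_rootField hp'⟩ : rootField ρ oddPrimes) ^ p = τ := Subtype.ext (h p hp')
  have := congrArg Subtype.val (congrArg e hpow)
  rw [map_pow] at this
  exact this

end Generic

-- Transcendence and countability of the ambient field

section Transcendence

instance faithfulSMul_polynomial_QtBar : FaithfulSMul ℚ[X] QtBar :=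
  FaithfulSMul.trans ℚ[X] (RatFunc ℚ) QtBar

instance isAlgebraic_polynomial_QtBar : Algebra.IsAlgebraic ℚ[X] QtBar :=
  (IsFractionRing.comap_isAlgebraic_iff (A := ℚ[X]) (K := RatFunc ℚ) (C := QtBar)).2 inferInstance

theorem isTranscendenceBasis_tElt : IsTranscendenceBasis ℚ (fun _ : Fin 1 => tElt) := by
  have : IsTranscendenceBasis ℚ (algebraMap ℚ[X] QtBar ∘ fun _ : Fin 1 => (X : ℚ[X])) :=
    (IsTranscendenceBasis.polynomial (Fin 1) ℚ).algebraMap_comp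
  convert this using 1
  funext i
  rw [Function.comp_apply, IsScalarTower.algebraMap_apply ℚ[X] (RatFunc ℚ) QtBar,
    RatFunc.algebraMap_X]
  rfl

theorem transcendental_tElt : Transcendental ℚ tElt :=
  isTranscendenceBasis_tElt.1.transcendental 0

instance countable_QtBar : Countable QtBar := by
  rw [← Cardinal.mk_le_aleph0_iff]
  have : Module.IsTorsionFree ℚ[X] QtBar := inferInstance
  refine (Algebra.IsAlgebraic.cardinalMk_le_max ℚ[X] QtBar).trans (max_le ?_ le_rfl)
  exact Polynomial.cardinalMk_le_max.trans (by simp)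

end Transcendence

theorem exists_isOddRootSystem : ∃ ρ : ℕ → QtBar, IsOddRootSystem ρ := by
  choose ρ hρ using fun p : ℕ => fun hp : 0 < p => IsAlgClosed.exists_pow_nat_eq tElt hp
  exact ⟨fun p => if hp : 0 < p then ρ p hp else 0, fun p hp _ => by
    simp only [dif_pos hp.pos, hρ]⟩

-- Transfer to the subfield generated by the odd roots

section OddRootField

variable {ρ : ℕ → QtBar}

/-- The value `ρ 1` is arbitrary in the hypothesis, so it is reset to `t`. -/
theorem IsOddRootSystem.isRootSystem (hρ : IsOddRootSystem ρ) :
    IsRootSystem tElt (Function.update ρ 1 tElt) := by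
  rintro p (rfl | hp)
  · rw [Function.update_self, pow_one]
  · rw [Function.update_of_ne hp.1.ne_one]
    exact hρ p hp.1 hp.2

theorem mem_oddRootField_iff (hρ : IsOddRootSystem ρ) {x : QtBar} :
    x ∈ oddRootField ρ ↔ x ∈ rootField (Function.update ρ 1 tElt) oddPrimes := by
  constructor
  · intro hx
    have hle : oddRootField ρ ≤ (rootField (Function.update ρ 1 tElt) oddPrimes).toSubfield := by
      refine Subfield.closure_le.2 ?_
      rintro _ ⟨p, hp, hp2, rfl⟩
      have := mem_rootField (ρ := Function.update ρ 1 tElt)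
        (Set.mem_insert_of_mem 1 (show p ∈ oddPrimes from ⟨hp, hp2⟩))
      rwa [Function.update_of_ne hp.ne_one] at this
    exact hle hx
  · intro hx
    let E : IntermediateField ℚ QtBar := (oddRootField ρ).toIntermediateField fun q => by
      rw [eq_ratCast]
      exact SubfieldClass.ratCast_mem _ q
    have hle : rootField (Function.update ρ 1 tElt) oddPrimes ≤ E := by
      refine rootField_le ?_
      rintro p (rfl | hp)
      · rw [Function.update_self]
        exact tElt_mem_oddRootField hρ
      · rw [Function.update_of_ne hp.1.ne_one]
        exact Subfield.subset_closure ⟨p, hp.1, hp.2, rfl⟩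
    exact hle hx

/-- A subfield and an intermediate field with the same elements are isomorphic. -/
def ringEquivOfMemIff {K : Type} [Field K] [Algebra ℚ K] {F : Subfield K}
    {E : IntermediateField ℚ K} (h : ∀ x, x ∈ F ↔ x ∈ E) : F ≃+* E where
  toFun x := ⟨x, (h x).1 x.2⟩
  invFun x := ⟨x, (h x).2 x.2⟩
  left_inv _ := rfl
  right_inv _ := rfl
  map_mul' _ _ := rfl
  map_add' _ _ := rfl

theorem coe_ringEquivOfMemIff {K : Type} [Field K] [Algebra ℚ K] {F : Subfield K}
    {E : IntermediateField ℚ K} (h : ∀ x, x ∈ F ↔ x ∈ E) (x : F) :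
    (ringEquivOfMemIff h x : K) = x :=
  rfl

theorem ringEquivOfMemIff_symm_apply {K : Type} [Field K] [Algebra ℚ K] {F : Subfield K}
    {E : IntermediateField ℚ K} (h : ∀ x, x ∈ F ↔ x ∈ E) (x : E) :
    ((ringEquivOfMemIff h).symm x : K) = x :=
  rfl

theorem isTranscendenceBasis_oddRootField (hρ : IsOddRootSystem ρ) :
    IsTranscendenceBasis ℚ
      (fun _ : Fin 1 => (⟨tElt, tElt_mem_oddRootField hρ⟩ : oddRootField ρ)) := by
  refine IsTranscendenceBasis.of_comp (oddRootField ρ).subtype.toRatAlgHom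
    (oddRootField ρ).subtype.injective ?_
  convert isTranscendenceBasis_tElt
  rfl

theorem isFD_oddRootField (hρ : IsOddRootSystem ρ) : IsFD 1 (oddRootField ρ) := by
  refine ⟨inferInstance, ?_⟩
  rw [← (isTranscendenceBasis_oddRootField hρ).cardinalMk_eq_trdeg]
  simp

theorem not_definesOrbit_of_isSigma_two (hρ : IsOddRootSystem ρ) {φ : InfFormula fieldLang 1}
    (hφ : φ.IsSigma 2) : ¬ φ.DefinesOrbit
      (fun _ : Fin 1 => (⟨tElt, tElt_mem_oddRootField hρ⟩ : oddRootField ρ)) := by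
  intro hdef
  have h := hρ.isRootSystem
  set E := ringEquivOfMemIff fun x => mem_oddRootField_iff hρ (x := x) with hE
  set τ : oddRootField ρ := ⟨tElt, tElt_mem_oddRootField hρ⟩ with hτ
  have hr : φ.Realize (fun _ : Fin 1 => τ) := (hdef _).2 ⟨FirstOrder.Language.Equiv.refl _ _,
    fun _ => rfl⟩
  have hr' : φ.Realize (fun _ : Fin 1 => E τ) := hφ.realize_comp_equiv le_rfl E.symm _ hr
  obtain ⟨q, hq, hrq⟩ := h.exists_realize_root transcendental_tElt hφ
    (coe_ringEquivOfMemIff _ τ) hr'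
  have hrq' := hφ.realize_comp_equiv le_rfl E _ hrq
  obtain ⟨σ, hσ⟩ := (hdef _).1 hrq'
  set f := InfFormula.ringEquivOfEquiv σ
  have hq1 : q ≠ 1 := hq.1.ne_one
  set r : oddRootField ρ := ⟨ρ q, Subfield.subset_closure ⟨q, hq.1, hq.2, rfl⟩⟩ with hr
  have hrτ : r ^ q = τ := Subtype.ext (hρ q hq.1 hq.2)
  -- The automorphism `f` takes `t` to `ρ q`, hence the `q`-th root `r` of `t` to a `q`-th root of
  -- `ρ q`.
  refine h.pow_ne transcendental_tElt hq (E (f r)).2 ?_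
  rw [coe_ringEquivOfMemIff]
  have h1 : f r ^ q = f τ := by rw [← map_pow, hrτ]
  have h2 := congrArg Subtype.val (h1.trans (hσ 0))
  rw [Function.comp_apply, ringEquivOfMemIff_symm_apply] at h2
  exact h2

theorem not_isScottSentence_of_isPi_three (hρ : IsOddRootSystem ρ) {φ : InfFormula fieldLang 0}
    (hφ : φ.IsPi 3) : ¬ φ.IsScottSentence (oddRootField ρ) := by
  intro hS
  have h := hρ.isRootSystem
  let E := ringEquivOfMemIff fun x => mem_oddRootField_iff hρ (x := x)
  obtain ⟨R, hR, hinf, hr⟩ := h.exists_realize_coinfinite transcendental_tElt hφ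
    ((hS _).2 ⟨InfFormula.equivOfRingEquiv E⟩)
  obtain ⟨σ⟩ := (hS _).1 hr
  exact (h.isEmpty_ringEquiv transcendental_tElt hR hinf).false
    (E.symm.trans (InfFormula.ringEquivOfEquiv σ))

end OddRootField

end

theorem mainTheorem12 :
    (∃ ρ : ℕ → QtBar, IsOddRootSystem ρ) ∧
    ∀ (ρ : ℕ → QtBar) (hρ : IsOddRootSystem ρ),
      IsFD 1 (oddRootField ρ) ∧
      IsTranscendenceBasis ℚ
        (fun _ : Fin 1 => (⟨tElt, tElt_mem_oddRootField hρ⟩ : oddRootField ρ)) ∧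
      (¬ ∃ φ : InfFormula fieldLang 1, InfFormula.IsSigma 2 φ ∧
        φ.DefinesOrbit
          (fun _ : Fin 1 => (⟨tElt, tElt_mem_oddRootField hρ⟩ : oddRootField ρ))) ∧
      (¬ ∃ φ : InfFormula fieldLang 0, InfFormula.IsPi 3 φ ∧
        φ.IsScottSentence (oddRootField ρ)) :=
  ⟨exists_isOddRootSystem, fun _ hρ => ⟨isFD_oddRootField hρ, isTranscendenceBasis_oddRootField hρ,
    fun ⟨_, hφ, hdef⟩ => not_definesOrbit_of_isSigma_two hρ hφ hdef,
    fun ⟨_, hφ, hS⟩ => not_isScottSentence_of_isPi_three hρ hφ hS⟩⟩
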